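/- Let $k$ be a field of characteristic $0$ (for instance $k=\mathbb{C}$) and let $K$ be the field of Puiseux series over $k$, i.e. of formal series $a=\sum_{q\in\mathbb{Q}}a_qt^q$ with $a_q\in k$ whose set of exponents $\{q : a_q\neq 0\}$ is bounded below and has a common denominator; for $a\ne 0$ let $\mathrm{val}(a)$ be the least exponent of $a$. For an ideal $I\subseteq K[x_1,\dots,x_N]$ consider the two usual descriptions of its tropical variety (for algebraically closed $k$ they define the same set $\mathcal{T}(I)\subseteq\mathbb{R}^N$): 1. $\mathcal{T}_1(I)$ is the set of all $x\in\mathbb{R}^N$ such that for every nonzero $f=\sum_a g_a x^a\in I$ the maximum of the numbers $-\mathrm{val}(g_a)+\sum_i a_ix_i$ over all $a$ with $g_a\neq 0$ is attained at least twice; 2. $\mathcal{T}_2(I)$ is the closure in $\mathbb{R}^N$ of the set of all points $(-\mathrm{val}(y_1),\dots,-\mathrm{val}(y_N))$ where $y\in K^N$ is a zero of $I$ with all $y_i\neq 0$. For natural numbers $m,n$ let $I_{m,n}$ be the Plücker ideal, i.e. the ideal of all polynomials over $\mathbb{Z}$ in variables $x_{i_1\dots i_m}$ ($1\le i_1<\dots<i_m\le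 n$) that vanish on the $m\times m$ minors of the generic $m\times n$ matrix over $\mathbb{Z}$, and let the tropical Grassmannian $\mathcal{G}_{m,n}\subseteq\mathbb{R}^{\binom nm}$ be the tropical variety of the ideal generated by $I_{m,n}$ over $K$. For $m\ge 2$ let $\phi^{(m)}:\mathbb{R}^{\binom n2}\to\mathbb{R}^{\binom nm}$ be the map $(X_{i,j})\mapsto (X_{i_1,\dots,i_m})$ with $$X_{i_1,\dots,i_m}=\frac12\min_{\sigma}\sum_{r=0}^{m-1}X_{i_{\sigma^{r}(1)},\,i_{\sigma^{r+1}(1)}},$$ where $\sigma$ runs over the $m$-cycles in the symmetric group $S_m$ and $X_{j,i}=X_{i,j}$; so $\phi^{(3)}$ sends $X$ to the point with coordinates $\frac12(X_{i,j}+X_{i,k}+X_{j,k})$, $i<j<k$. Then, for every $n\in\mathbb{N}$, $$\phi^{(3)}(\mathcal{G}_{2,n})\subseteq\mathcal{G}_{3,n},$$ both when $\mathcal{G}_{2,n}$ and $\mathcal{G}_{3,n}$ are defined through $\mathcal{T}_1$ and when they are defined through $\mathcal{T}_2$. -/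

import Mathlib

open scoped BigOperators

noncomputable section

namespace TropicalDissimilarity

/-! ### The field of Puiseux series -/

section Puiseux

variable (k : Type*) [Field k]

/-- The ring homomorphism `t ↦ t ^ (1 / N)` from formal Laurent series over `k` to Hahn series
with exponents in `ℚ`. -/
def ramify (N : ℕ) (hN : 0 < N) : HahnSeries ℤ k →+* HahnSeries ℚ k :=
  have hN' : (0 : ℚ) < N := Nat.cast_pos.mpr hN
  HahnSeries.embDomainRingHom
    { toFun := fun z : ℤ => (z : ℚ) / N
      map_zero' := by simp
      map_add' := fun a b => by push_cast; ring }
    (fun a b h => by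
      have h' : (a : ℚ) / N = (b : ℚ) / N := h
      rw [div_left_inj' hN'.ne'] at h'
      exact_mod_cast h')
    (fun a b => by
      change (a : ℚ) / N ≤ (b : ℚ) / N ↔ a ≤ b
      rw [div_le_div_iff_of_pos_right hN']
      exact_mod_cast Iff.rfl)

variable {k} in
theorem mem_fieldRange_ramify (N : ℕ) (hN : 0 < N) (a : HahnSeries ℚ k) :
    a ∈ (ramify k N hN).fieldRange ↔ ∀ q ∈ a.support, ∃ z : ℤ, q = (z : ℚ) / N := by
  have hN' : (0 : ℚ) < N := Nat.cast_pos.mpr hN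
  constructor
  · rintro ⟨b, rfl⟩ q hq
    obtain ⟨z, -, hz⟩ := HahnSeries.support_embDomain_subset hq
    exact ⟨z, hz.symm⟩
  · intro h
    have hpwo : (Function.support fun z : ℤ => a.coeff ((z : ℚ) / N)).IsPWO := by
      rw [Set.isPWO_iff_isWF]
      have hwf := a.isWF_support
      rw [Set.isWF_iff_no_descending_seq] at hwf ⊢
      intro f hf hmem
      refine hwf (fun i => (f i : ℚ) / N) (fun i j hij => ?_) (fun i => ?_)
      · have : f j < f i := hf hij
        have h2 : (f j : ℚ) < f i := by exact_mod_cast this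
        exact div_lt_div_of_pos_right h2 hN'
      · exact hmem i
    refine ⟨⟨fun z : ℤ => a.coeff ((z : ℚ) / N), hpwo⟩, ?_⟩
    ext q
    by_cases hq : ∃ z : ℤ, q = (z : ℚ) / N
    · obtain ⟨z, rfl⟩ := hq
      exact HahnSeries.embDomain_coeff
        (x := (⟨fun z : ℤ => a.coeff ((z : ℚ) / N), hpwo⟩ : HahnSeries ℤ k)) (a := z)
    · have h0 : a.coeff q = 0 := by
        by_contra hne
        exact hq (h q hne)
      rw [h0]
      refine HahnSeries.embDomain_of_notMem_range ?_
      rintro ⟨z, rfl⟩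
      exact hq ⟨z, rfl⟩

variable {k} in
theorem mem_fieldRange_ramify_mul {N : ℕ} (hN : 0 < N) {M : ℕ} (hM : 0 < M)
    {a : HahnSeries ℚ k} (ha : ∀ q ∈ a.support, ∃ z : ℤ, q = (z : ℚ) / N) :
    a ∈ (ramify k (N * M) (Nat.mul_pos hN hM)).fieldRange := by
  rw [mem_fieldRange_ramify]
  intro q hq
  obtain ⟨z, rfl⟩ := ha q hq
  have hM' : (M : ℚ) ≠ 0 := by exact_mod_cast hM.ne'
  exact ⟨z * M, by push_cast; rw [mul_div_mul_right _ _ hM']⟩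

/-- The field of Puiseux series `∑ a_q t ^ q` over `k`: the Hahn series with exponents in `ℚ`
whose exponents have a common denominator.  (For such a family of coefficients, well-ordered
support is the same as support bounded below, see `isPWO_of_bddBelow`.) -/
def puiseuxSubfield : Subfield (HahnSeries ℚ k) where
  carrier := {a | ∃ N : ℕ, 0 < N ∧ ∀ q ∈ a.support, ∃ z : ℤ, q = (z : ℚ) / N}
  mul_mem' := by
    rintro a b ⟨N, hN, ha⟩ ⟨M, hM, hb⟩
    have ha' := mem_fieldRange_ramify_mul hN hM ha
    have hb' := mem_fieldRange_ramify_mul hM hN hb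
    simp only [Nat.mul_comm M N] at hb'
    exact ⟨N * M, Nat.mul_pos hN hM, (mem_fieldRange_ramify _ _ _).1 (mul_mem ha' hb')⟩
  add_mem' := by
    rintro a b ⟨N, hN, ha⟩ ⟨M, hM, hb⟩
    have ha' := mem_fieldRange_ramify_mul hN hM ha
    have hb' := mem_fieldRange_ramify_mul hM hN hb
    simp only [Nat.mul_comm M N] at hb'
    exact ⟨N * M, Nat.mul_pos hN hM, (mem_fieldRange_ramify _ _ _).1 (add_mem ha' hb')⟩
  one_mem' := ⟨1, one_pos, (mem_fieldRange_ramify _ one_pos _).1 (one_mem _)⟩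
  zero_mem' := ⟨1, one_pos, (mem_fieldRange_ramify _ one_pos _).1 (zero_mem _)⟩
  neg_mem' := by
    rintro a ⟨N, hN, ha⟩
    exact ⟨N, hN, (mem_fieldRange_ramify _ hN _).1
      (neg_mem ((mem_fieldRange_ramify _ hN _).2 ha))⟩
  inv_mem' := by
    rintro a ⟨N, hN, ha⟩
    exact ⟨N, hN, (mem_fieldRange_ramify _ hN _).1
      (inv_mem ((mem_fieldRange_ramify _ hN _).2 ha))⟩

/-- A set of rational numbers with a common denominator that is bounded below is partially
well-ordered. -/
theorem isPWO_of_bddBelow {s : Set ℚ} (hs : BddBelow s) {N : ℕ} (hN : 0 < N)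
    (h : ∀ q ∈ s, ∃ z : ℤ, q = (z : ℚ) / N) : s.IsPWO := by
  have hN' : (0 : ℚ) < N := Nat.cast_pos.mpr hN
  obtain ⟨b, hb⟩ := hs
  have hpre : {z : ℤ | (z : ℚ) / N ∈ s}.IsPWO := by
    refine (BddBelow.isWF ⟨⌊b * N⌋, fun z hz => ?_⟩).isPWO
    have h1 : b ≤ (z : ℚ) / N := hb hz
    rw [le_div_iff₀ hN'] at h1
    exact_mod_cast (Int.floor_le (b * N)).trans h1
  refine (hpre.image_of_monotone (f := fun z : ℤ => (z : ℚ) / N) fun x y hxy => ?_).mono ?_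
  · have : (x : ℚ) ≤ y := by exact_mod_cast hxy
    exact div_le_div_of_nonneg_right this hN'.le
  · intro q hq
    obtain ⟨z, rfl⟩ := h q hq
    exact ⟨z, hq, rfl⟩

/-- The field of Puiseux series over `k`. -/
abbrev Puiseux : Type _ := puiseuxSubfield k

variable {k} in
/-- The valuation of a nonzero Puiseux series, i.e. its least exponent (used below for nonzero
series only). -/
def val (a : Puiseux k) : ℝ := ((a : HahnSeries ℚ k).order : ℚ)

end Puiseux

/-! ### Tropical varieties -/

section Tropical

variable {k : Type*} [Field k] {ι : Type*} [Fintype ι]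

/-- The exponent of the tropical monomial of `trop f` at `a`, as a function of `x`:
`λ_a + ∑ i, a_i x_i` with `λ_a = -val (g_a)`, where `g_a` is the coefficient of `f` at `a`. -/
def tropTerm (f : MvPolynomial ι (Puiseux k)) (a : ι →₀ ℕ) (x : ι → ℝ) : ℝ :=
  -val (f.coeff a) + ∑ i, (a i : ℝ) * x i

/-- The tropical hypersurface of a nonzero polynomial `f`: the points at which the maximum over
the monomials of `trop f` is attained at least twice. -/
def tropicalHypersurface (f : MvPolynomial ι (Puiseux k)) : Set (ι → ℝ) :=
  {x | ∃ a ∈ f.support, ∃ b ∈ f.support, a ≠ b ∧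
    (∀ c ∈ f.support, tropTerm f c x ≤ tropTerm f a x) ∧
    (∀ c ∈ f.support, tropTerm f c x ≤ tropTerm f b x)}

/-- The tropical variety of an ideal as the intersection of all tropical hypersurfaces of its
nonzero members. -/
def tropicalVariety (I : Ideal (MvPolynomial ι (Puiseux k))) : Set (ι → ℝ) :=
  {x | ∀ f ∈ I, f ≠ 0 → x ∈ tropicalHypersurface f}

/-- The tropical variety of an ideal as the closure of the set of the negatives of the
valuations of the zeros of the ideal with nonzero coordinates. -/
def tropicalVarietyClosure (I : Ideal (MvPolynomial ι (Puiseux k))) : Set (ι → ℝ) :=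
  closure {x | ∃ y ∈ MvPolynomial.zeroLocus (Puiseux k) I,
    (∀ i, y i ≠ 0) ∧ x = fun i => -val (y i)}

end Tropical

/-! ### The tropical Grassmannian -/

/-- The index set of the coordinates of `ℝ ^ (n choose m)`: the strictly increasing sequences
`i₁ < ⋯ < i_m` in `Fin n`. -/
abbrev Idx (m n : ℕ) : Type := Fin m ↪o Fin n

/-- The `m × m` minor with columns `s` of the generic `m × n` matrix over `ℤ`. -/
def genericMinor (m n : ℕ) (s : Idx m n) : MvPolynomial (Fin m × Fin n) ℤ :=
  ((Matrix.mvPolynomialX (Fin m) (Fin n) ℤ).submatrix id s).det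

/-- The Plücker ideal `I_{m,n} ⊆ ℤ[x]`: the algebraic relations among the `m × m` minors of the
generic `m × n` matrix. -/
def pluckerIdeal (m n : ℕ) : Ideal (MvPolynomial (Idx m n) ℤ) :=
  RingHom.ker (MvPolynomial.aeval (genericMinor m n) :
    MvPolynomial (Idx m n) ℤ →ₐ[ℤ] MvPolynomial (Fin m × Fin n) ℤ)

/-- The ideal generated by `I_{m,n}` in the polynomial ring over the Puiseux series. -/
def pluckerIdealPuiseux (k : Type*) [Field k] (m n : ℕ) :
    Ideal (MvPolynomial (Idx m n) (Puiseux k)) :=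
  (pluckerIdeal m n).map (MvPolynomial.map (Int.castRingHom (Puiseux k)))

/-- The tropical Grassmannian `G_{m,n}`, through tropical hypersurfaces. -/
def tropicalGrassmannian (k : Type*) [Field k] (m n : ℕ) : Set (Idx m n → ℝ) :=
  tropicalVariety (pluckerIdealPuiseux k m n)

/-- The tropical Grassmannian `G_{m,n}`, as a closure of a set of valuations. -/
def tropicalGrassmannianClosure (k : Type*) [Field k] (m n : ℕ) : Set (Idx m n → ℝ) :=
  tropicalVarietyClosure (pluckerIdealPuiseux k m n)

/-! ### The map `φ^(m)` -/

/-- The pair `i < j` as an index. -/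
def pairIdx {n : ℕ} (i j : Fin n) (h : i < j) : Idx 2 n :=
  OrderEmbedding.ofStrictMono ![i, j] (by
    intro a b hab
    fin_cases a <;> fin_cases b <;> simp_all)

/-- The symmetric matrix with zero diagonal whose entries above the diagonal are the
coordinates of `X ∈ ℝ ^ (n choose 2)`. -/
def dissim {n : ℕ} (X : Idx 2 n → ℝ) (i j : Fin n) : ℝ :=
  if h : i < j then X (pairIdx i j h) else if h : j < i then X (pairIdx j i h) else 0

/-- The map `φ^(m) : ℝ ^ (n choose 2) → ℝ ^ (n choose m)` for `m ≥ 2`: half of the minimum over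
the `m`-cycles `σ` of `∑ r < m, X (i_{σ^r(1)}, i_{σ^(r+1)(1)})`. -/
def phi (m : ℕ) [NeZero m] {n : ℕ} (X : Idx 2 n → ℝ) : Idx m n → ℝ := fun s =>
  1 / 2 * ⨅ σ : {σ : Equiv.Perm (Fin m) // σ.cycleType = {m}},
    ∑ r ∈ Finset.range m, dissim X (s ((σ.1 ^ r) 0)) (s ((σ.1 ^ (r + 1)) 0))

theorem dissim_comm {n : ℕ} (X : Idx 2 n → ℝ) (i j : Fin n) : dissim X i j = dissim X j i := by
  unfold dissim
  rcases lt_trichotomy i j with h | h | h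
  · simp [h, h.not_gt]
  · simp [h]
  · simp [h, h.not_gt]

/-- For `m = 3` the minimum is over two cycles with the same value. -/
theorem phi_three {n : ℕ} (X : Idx 2 n → ℝ) (s : Idx 3 n) :
    phi 3 X s =
      1 / 2 * (dissim X (s 0) (s 1) + dissim X (s 0) (s 2) + dissim X (s 1) (s 2)) := by
  have key : ∀ σ : Equiv.Perm (Fin 3), σ.cycleType = {3} →
      (σ 0 = 1 ∧ σ 1 = 2 ∧ σ 2 = 0) ∨ (σ 0 = 2 ∧ σ 2 = 1 ∧ σ 1 = 0) := by decide
  have hne : Nonempty {σ : Equiv.Perm (Fin 3) // σ.cycleType = {3}} :=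
    ⟨⟨finRotate 3, by decide⟩⟩
  unfold phi
  congr 1
  rw [← ciInf_const (ι := {σ : Equiv.Perm (Fin 3) // σ.cycleType = {3}})
    (a := dissim X (s 0) (s 1) + dissim X (s 0) (s 2) + dissim X (s 1) (s 2))]
  congr 1
  funext σ
  have hc1 := dissim_comm X (s 2) (s 0)
  have hc2 := dissim_comm X (s 1) (s 0)
  have hc3 := dissim_comm X (s 2) (s 1)
  rcases key σ.1 σ.2 with ⟨h0, h1, h2⟩ | ⟨h0, h1, h2⟩ <;>
    simp only [Finset.sum_range_succ, Finset.sum_range_zero, pow_succ, pow_zero, one_mul,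
      Equiv.Perm.mul_apply, Equiv.Perm.one_apply, h0, h1, h2] <;> linarith

end TropicalDissimilarity

end

/-!
Sending a column `(a, b)` of a `2 × n` matrix to the column `(b ^ i * a ^ (m - 1 - i))` on the cone
over the rational normal curve turns every `m × m` minor into a Vandermonde determinant, that is,
into the product of the `2 × 2` minors over all pairs of its columns. Hence the monomial map
`x_s ↦ ∏_{i < j} x_{s i, s j}` carries the Plücker ideal `I_{m,n}` into `I_{2,n}`. A monomial map
tropicalizes to the linear map with the same exponents, here `X ↦ ∑_{i < j} X_{s i, s j}`, so this
linear map sends `G_{2,n}` into `G_{m,n}`. Finally the Plücker ideal has integer coefficients, which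
are fixed by the substitution `t ↦ t ^ c`, and this substitution multiplies all valuations by `c`;
thus `G_{m,n}` is stable under scaling by a rational `c > 0`. For `m = 3` and `c = 1 / 2` the
resulting map is `φ^(3)`.
-/

noncomputable section

namespace TropicalDissimilarity

open MvPolynomial

/-! ### The valuation of Puiseux series -/

section Valuation

variable {k : Type*} [Field k]

variable (k) in
/-- The valuation `val` as an additive valuation, which is `⊤` at `0` where `val` has the junk
value `0`. -/
def puiseuxVal : AddValuation (Puiseux k) (WithTop ℝ) :=
  ((HahnSeries.addVal ℚ k).comap (puiseuxSubfield k).subtype).map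
    (Rat.castHom ℝ).toAddMonoidHom.withTopMap rfl (WithTop.monotone_map_iff.2 Rat.cast_mono)

theorem puiseuxVal_of_ne_zero {a : Puiseux k} (ha : a ≠ 0) : puiseuxVal k a = (val a : ℝ) :=
  congrArg (WithTop.map ((↑) : ℚ → ℝ))
    (HahnSeries.addVal_apply_of_ne (by exact_mod_cast ha : (a : HahnSeries ℚ k) ≠ 0))

theorem val_one : val (1 : Puiseux k) = 0 := by
  simp [val]

theorem val_mul {a b : Puiseux k} (ha : a ≠ 0) (hb : b ≠ 0) : val (a * b) = val a + val b := by
  have h := (puiseuxVal k).map_mul a b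
  rw [puiseuxVal_of_ne_zero (mul_ne_zero ha hb), puiseuxVal_of_ne_zero ha,
    puiseuxVal_of_ne_zero hb] at h
  exact_mod_cast h

theorem val_pow {a : Puiseux k} (ha : a ≠ 0) (m : ℕ) : val (a ^ m) = m * val a := by
  induction m with
  | zero => simp [val_one]
  | succ m ih =>
    rw [pow_succ, val_mul (pow_ne_zero m ha) ha, ih]
    push_cast
    ring

theorem val_prod {β : Type*} (S : Finset β) {g : β → Puiseux k} (hg : ∀ b ∈ S, g b ≠ 0) :
    val (∏ b ∈ S, g b) = ∑ b ∈ S, val (g b) := by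
  classical
  induction S using Finset.induction_on with
  | empty => simp [val_one]
  | insert b S hb ih =>
    rw [Finset.forall_mem_insert] at hg
    rw [Finset.prod_insert hb, Finset.sum_insert hb,
      val_mul hg.1 (Finset.prod_ne_zero_iff.2 hg.2), ih hg.2]

end Valuation

/-! ### Dominant monomials -/

section Dominant

variable {k : Type*} [Field k] {ι : Type*} [Fintype ι]

/-- The maximum that defines `trop f` is attained at `x` by the monomial with exponent `a` and by
no other monomial. -/
def IsDominant (f : MvPolynomial ι (Puiseux k)) (a : ι →₀ ℕ) (x : ι → ℝ) : Prop :=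
  a ∈ f.support ∧ ∀ b ∈ f.support, b ≠ a → tropTerm f b x < tropTerm f a x

theorem exists_isDominant_iff {f : MvPolynomial ι (Puiseux k)} {x : ι → ℝ} :
    (∃ a, IsDominant f a x) ↔ f ≠ 0 ∧ x ∉ tropicalHypersurface f := by
  constructor
  · rintro ⟨a, ha, hlt⟩
    refine ⟨support_nonempty.1 ⟨a, ha⟩, ?_⟩
    rintro ⟨b, hb, c, hc, hbc, hbmax, hcmax⟩
    by_cases hba : b = a
    · exact (hlt c hc fun hca => hbc (hba.trans hca.symm)).not_ge (hcmax a ha)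
    · exact (hlt b hb hba).not_ge (hbmax a ha)
  · rintro ⟨hf, hx⟩
    obtain ⟨a, ha, hmax⟩ := f.support.exists_max_image (tropTerm f · x) (support_nonempty.2 hf)
    refine ⟨a, ha, fun b hb hba => lt_of_not_ge fun hle => hx ?_⟩
    exact ⟨a, ha, b, hb, hba.symm, hmax, fun c hc => (hmax c hc).trans hle⟩

theorem mem_tropicalVariety_iff {I : Ideal (MvPolynomial ι (Puiseux k))} {x : ι → ℝ} :
    x ∈ tropicalVariety I ↔ ∀ f ∈ I, ∀ a, ¬ IsDominant f a x := by
  simp only [← not_exists, exists_isDominant_iff, not_and, not_not]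
  rfl

theorem isDominant_iff_lt_puiseuxVal {f : MvPolynomial ι (Puiseux k)} {a : ι →₀ ℕ}
    {x : ι → ℝ} :
    IsDominant f a x ↔ f.coeff a ≠ 0 ∧ ∀ b, b ≠ a →
      ((∑ i, (b i : ℝ) * x i - tropTerm f a x : ℝ) : WithTop ℝ) < puiseuxVal k (f.coeff b) := by
  rw [IsDominant, mem_support_iff]
  refine and_congr_right fun _ => forall_congr' fun b => ?_
  by_cases hb : f.coeff b = 0
  · simp only [mem_support_iff, hb, ne_eq, not_true_eq_false, false_imp_iff, imp_true_iff,
      AddValuation.map_zero, WithTop.coe_lt_top]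
  rw [puiseuxVal_of_ne_zero hb, WithTop.coe_lt_coe, tropTerm]
  simp only [mem_support_iff, ne_eq, hb, not_false_eq_true, forall_const]
  refine imp_congr_right fun _ => ?_
  constructor <;> intro h <;> linarith

end Dominant

/-! ### Monomial maps -/

section MonomialMap

variable {ι κ : Type*}

/-- The monomial map `x_s ↦ x ^ (e s)` of polynomial rings. -/
def monomialHom (R : Type*) [CommSemiring R] (e : κ → ι →₀ ℕ) :
    MvPolynomial κ R →ₐ[R] MvPolynomial ι R :=
  bind₁ fun s => monomial (e s) 1

/-- The tropicalization of the monomial map `monomialHom`, as a map of points: the coordinate at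
`s` is the linear form with coefficients `e s`. -/
def tropMonomialMap [Fintype ι] (e : κ → ι →₀ ℕ) (x : ι → ℝ) (s : κ) : ℝ :=
  ∑ i, (e s i : ℝ) * x i

theorem monomialHom_monomial {R : Type*} [CommSemiring R] (e : κ → ι →₀ ℕ) (a : κ →₀ ℕ) (r : R) :
    monomialHom R e (monomial a r) = monomial (a.linearCombination ℕ e) r := by
  rw [monomialHom, bind₁_monomial, Finsupp.linearCombination_apply, monomial_finsupp_sum_index]
  simp [monomial_pow, Finsupp.prod]

theorem coeff_monomialHom {R : Type*} [CommSemiring R] [DecidableEq ι] (e : κ → ι →₀ ℕ)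
    (f : MvPolynomial κ R) (d : ι →₀ ℕ) :
    (monomialHom R e f).coeff d =
      ∑ a ∈ f.support with a.linearCombination ℕ e = d, f.coeff a := by
  conv_lhs => rw [f.as_sum, map_sum, coeff_sum]
  simp only [monomialHom_monomial, coeff_monomial, Finset.sum_filter]

theorem map_map_le_comap_monomialHom {R S : Type*} [CommSemiring R] [CommSemiring S] (φ : R →+* S)
    (e : κ → ι →₀ ℕ) {I : Ideal (MvPolynomial κ R)} {J : Ideal (MvPolynomial ι R)}
    (h : I ≤ J.comap (monomialHom R e)) :
    I.map (MvPolynomial.map φ) ≤ (J.map (MvPolynomial.map φ)).comap (monomialHom S e) := by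
  rw [Ideal.map_le_iff_le_comap]
  intro f hf
  have hmem := Ideal.mem_map_of_mem (MvPolynomial.map φ) (Ideal.mem_comap.1 (h hf))
  have hcomm : MvPolynomial.map φ (monomialHom R e f) =
      monomialHom S e (MvPolynomial.map φ f) := by
    simp only [monomialHom, map_bind₁, map_monomial, map_one]
  rwa [hcomm] at hmem

variable [Fintype ι]

theorem continuous_tropMonomialMap (e : κ → ι →₀ ℕ) : Continuous (tropMonomialMap e) := by
  unfold tropMonomialMap
  fun_prop

variable {k : Type*} [Field k]

theorem tropMonomialMap_neg_val (e : κ → ι →₀ ℕ) {y : ι → Puiseux k} (hy : ∀ i, y i ≠ 0) (s : κ) :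
    tropMonomialMap e (fun i => -val (y i)) s = -val (∏ i, y i ^ e s i) := by
  rw [val_prod _ fun i _ => pow_ne_zero _ (hy i)]
  simp only [tropMonomialMap, val_pow (hy _), mul_neg, Finset.sum_neg_distrib]

theorem tropMonomialMap_mem_tropicalVarietyClosure {e : κ → ι →₀ ℕ}
    {I : Ideal (MvPolynomial κ (Puiseux k))} {J : Ideal (MvPolynomial ι (Puiseux k))}
    (h : I ≤ J.comap (monomialHom (Puiseux k) e)) {x : ι → ℝ}
    (hx : x ∈ tropicalVarietyClosure J) : tropMonomialMap e x ∈ tropicalVarietyClosure I := by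
  refine map_mem_closure (continuous_tropMonomialMap e) hx ?_
  rintro _ ⟨y, hy, hy0, rfl⟩
  refine ⟨fun s => ∏ i, y i ^ e s i, fun f hf => ?_,
    fun s => Finset.prod_ne_zero_iff.2 fun i _ => pow_ne_zero _ (hy0 i),
    funext (tropMonomialMap_neg_val e hy0)⟩
  have hzero := hy _ (h hf)
  rw [monomialHom, aeval_bind₁] at hzero
  simpa [aeval_monomial, Finsupp.prod_fintype] using hzero

variable [Fintype κ]

theorem sum_mul_tropMonomialMap (e : κ → ι →₀ ℕ) (a : κ →₀ ℕ) (x : ι → ℝ) :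
    ∑ s, (a s : ℝ) * tropMonomialMap e x s =
      ∑ i, ((a.linearCombination ℕ e) i : ℝ) * x i := by
  rw [Finsupp.linearCombination_apply, Finsupp.sum_fintype _ _ (by simp)]
  simp only [tropMonomialMap, Finsupp.coe_finsetSum, Finset.sum_apply, Finsupp.smul_apply,
    smul_eq_mul, Nat.cast_sum, Nat.cast_mul, Finset.sum_mul, Finset.mul_sum]
  rw [Finset.sum_comm]
  simp only [mul_assoc]

theorem IsDominant.lt_puiseuxVal_sum {e : κ → ι →₀ ℕ} {f : MvPolynomial κ (Puiseux k)} {a : κ →₀ ℕ}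
    {x : ι → ℝ} (h : IsDominant f a (tropMonomialMap e x)) {S : Finset (κ →₀ ℕ)} {d : ι →₀ ℕ}
    (hS : ∀ b ∈ S, b ≠ a ∧ b.linearCombination ℕ e = d) :
    ((∑ i, (d i : ℝ) * x i - tropTerm f a (tropMonomialMap e x) : ℝ) : WithTop ℝ) <
      puiseuxVal k (∑ b ∈ S, f.coeff b) := by
  refine AddValuation.map_lt_sum _ WithTop.coe_ne_top fun b hb => ?_
  obtain ⟨hba, rfl⟩ := hS b hb
  rw [← sum_mul_tropMonomialMap]
  exact (isDominant_iff_lt_puiseuxVal.1 h).2 b hba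

-- The other monomials with the same image have coefficients of strictly larger valuation, so the
-- leading coefficient survives the collision.
theorem IsDominant.puiseuxVal_coeff_monomialHom {e : κ → ι →₀ ℕ} {f : MvPolynomial κ (Puiseux k)}
    {a : κ →₀ ℕ} {x : ι → ℝ} (h : IsDominant f a (tropMonomialMap e x)) :
    puiseuxVal k ((monomialHom (Puiseux k) e f).coeff (a.linearCombination ℕ e)) =
      puiseuxVal k (f.coeff a) := by
  classical
  have hval : puiseuxVal k (f.coeff a) = (val (f.coeff a) : ℝ) :=
    puiseuxVal_of_ne_zero (mem_support_iff.1 h.1)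
  have hweight : ∑ i, ((a.linearCombination ℕ e) i : ℝ) * x i -
      tropTerm f a (tropMonomialMap e x) = val (f.coeff a) := by
    rw [tropTerm, sum_mul_tropMonomialMap]
    ring
  have hfiber : a ∈ {b ∈ f.support | b.linearCombination ℕ e = a.linearCombination ℕ e} :=
    Finset.mem_filter.2 ⟨h.1, rfl⟩
  rw [coeff_monomialHom, ← Finset.add_sum_erase _ _ hfiber]
  refine AddValuation.map_add_eq_of_lt_left _ ?_
  rw [hval, ← hweight]
  refine h.lt_puiseuxVal_sum fun b hb => ?_
  rw [Finset.mem_erase, Finset.mem_filter] at hb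
  exact ⟨hb.1, hb.2.2⟩

theorem IsDominant.map_monomialHom {e : κ → ι →₀ ℕ} {f : MvPolynomial κ (Puiseux k)} {a : κ →₀ ℕ}
    {x : ι → ℝ} (h : IsDominant f a (tropMonomialMap e x)) :
    IsDominant (monomialHom (Puiseux k) e f) (a.linearCombination ℕ e) x := by
  classical
  have ha : f.coeff a ≠ 0 := mem_support_iff.1 h.1
  have hval := h.puiseuxVal_coeff_monomialHom
  have hlead : (monomialHom (Puiseux k) e f).coeff (a.linearCombination ℕ e) ≠ 0 := by
    rwa [← (puiseuxVal k).ne_top_iff, hval, (puiseuxVal k).ne_top_iff]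
  have hterm : tropTerm (monomialHom (Puiseux k) e f) (a.linearCombination ℕ e) x =
      tropTerm f a (tropMonomialMap e x) := by
    rw [puiseuxVal_of_ne_zero hlead, puiseuxVal_of_ne_zero ha, WithTop.coe_inj] at hval
    rw [tropTerm, tropTerm, sum_mul_tropMonomialMap, hval]
  refine isDominant_iff_lt_puiseuxVal.2 ⟨hlead, fun d hd => ?_⟩
  rw [hterm, coeff_monomialHom]
  refine h.lt_puiseuxVal_sum fun b hb => ?_
  obtain ⟨-, rfl⟩ := Finset.mem_filter.1 hb
  exact ⟨fun hba => hd (congrArg _ hba), rfl⟩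

theorem tropMonomialMap_mem_tropicalVariety {e : κ → ι →₀ ℕ}
    {I : Ideal (MvPolynomial κ (Puiseux k))} {J : Ideal (MvPolynomial ι (Puiseux k))}
    (h : I ≤ J.comap (monomialHom (Puiseux k) e)) {x : ι → ℝ} (hx : x ∈ tropicalVariety J) :
    tropMonomialMap e x ∈ tropicalVariety I := by
  rw [mem_tropicalVariety_iff] at hx ⊢
  exact fun f hf a ha => hx _ (h hf) _ ha.map_monomialHom

end MonomialMap

/-! ### Rescaling the exponents -/

section Rescaling

variable {k : Type*} [Field k]

/-- The substitution `t ↦ t ^ c` in Hahn series with rational exponents. -/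
def hahnSubstPow (c : ℚ) (hc : 0 < c) : HahnSeries ℚ k →+* HahnSeries ℚ k :=
  HahnSeries.embDomainRingHom (AddMonoidHom.mulLeft c)
    (fun _ _ h => mul_left_cancel₀ hc.ne' h) (fun _ _ => mul_le_mul_iff_right₀ hc)

theorem order_hahnSubstPow (c : ℚ) (hc : 0 < c) (a : HahnSeries ℚ k) :
    (hahnSubstPow c hc a).order = c * a.order := by
  obtain rfl | ha := eq_or_ne a 0
  · simp
  have hne : hahnSubstPow c hc a ≠ 0 := (map_ne_zero _).2 ha
  have h : (hahnSubstPow c hc a).orderTop = _ := HahnSeries.orderTop_embDomain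
  rw [← HahnSeries.order_eq_orderTop_of_ne_zero hne,
    ← HahnSeries.order_eq_orderTop_of_ne_zero ha] at h
  exact WithTop.coe_injective h

theorem hahnSubstPow_mem_puiseuxSubfield (c : ℚ) (hc : 0 < c) {a : HahnSeries ℚ k}
    (ha : a ∈ puiseuxSubfield k) : hahnSubstPow c hc a ∈ puiseuxSubfield k := by
  obtain ⟨N, hN, hsupp⟩ := ha
  refine ⟨N * c.den, Nat.mul_pos hN c.pos, fun q hq => ?_⟩
  obtain ⟨p, hp, rfl⟩ := HahnSeries.support_embDomain_subset hq
  obtain ⟨z, rfl⟩ := hsupp p hp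
  refine ⟨c.num * z, ?_⟩
  change c * ((z : ℚ) / N) = _
  push_cast
  rw [mul_comm (N : ℚ), mul_div_mul_comm, Rat.num_div_den]

/-- The substitution `t ↦ t ^ c` in Puiseux series. -/
def substPow (c : ℚ) (hc : 0 < c) : Puiseux k →+* Puiseux k :=
  (hahnSubstPow c hc).restrict (puiseuxSubfield k) (puiseuxSubfield k) fun _ =>
    hahnSubstPow_mem_puiseuxSubfield c hc

theorem val_substPow (c : ℚ) (hc : 0 < c) (a : Puiseux k) : val (substPow c hc a) = c * val a := by
  have hcoe : (substPow c hc a : HahnSeries ℚ k) = hahnSubstPow c hc a := rfl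
  rw [val, hcoe, order_hahnSubstPow, val]
  push_cast
  rfl

section Ideals

variable {ι R S : Type*} [CommSemiring R]

theorem map_map_le_comap_map [CommSemiring S] {φ : R →+* S} {σ : S →+* S} (hσ : σ.comp φ = φ)
    (J : Ideal (MvPolynomial ι R)) :
    J.map (MvPolynomial.map φ) ≤
      (J.map (MvPolynomial.map φ)).comap (MvPolynomial.map (σ := ι) σ) := by
  rw [Ideal.map_le_iff_le_comap]
  intro g hg
  rw [Ideal.mem_comap, Ideal.mem_comap, map_map, hσ]
  exact Ideal.mem_map_of_mem _ hg

theorem mem_zeroLocus_map_iff [Field S] {φ : R →+* S} {J : Ideal (MvPolynomial ι R)} {y : ι → S} :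
    y ∈ zeroLocus S (J.map (MvPolynomial.map φ)) ↔ ∀ f ∈ J, f.eval₂ φ y = 0 := by
  have h : y ∈ zeroLocus S (J.map (MvPolynomial.map φ)) ↔
      J.map (MvPolynomial.map φ) ≤ RingHom.ker (aeval (R := S) y) := Iff.rfl
  rw [h, Ideal.map_le_iff_le_comap]
  refine forall₂_congr fun f _ => ?_
  simp [Ideal.mem_comap, RingHom.mem_ker, aeval_def, eval₂_map]

theorem comp_mem_zeroLocus_map [Field S] {φ : R →+* S} {σ : S →+* S} (hσ : σ.comp φ = φ)
    {J : Ideal (MvPolynomial ι R)} {y : ι → S}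
    (hy : y ∈ zeroLocus S (J.map (MvPolynomial.map φ))) :
    σ ∘ y ∈ zeroLocus S (J.map (MvPolynomial.map φ)) := by
  rw [mem_zeroLocus_map_iff] at hy ⊢
  intro f hf
  rw [← hσ, ← eval₂_comp_left, hy f hf, map_zero]

end Ideals

variable {ι R : Type*} [CommSemiring R] {φ : R →+* Puiseux k}

theorem smul_mem_tropicalVarietyClosure_map {c : ℚ} (hc : 0 < c)
    (hφ : (substPow c hc).comp φ = φ) {J : Ideal (MvPolynomial ι R)} {x : ι → ℝ}
    (hx : x ∈ tropicalVarietyClosure (J.map (MvPolynomial.map φ))) :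
    (c : ℝ) • x ∈ tropicalVarietyClosure (J.map (MvPolynomial.map φ)) := by
  refine map_mem_closure (continuous_const_smul (c : ℝ)) hx ?_
  rintro _ ⟨y, hy, hy0, rfl⟩
  refine ⟨_, comp_mem_zeroLocus_map hφ hy, fun i => (map_ne_zero _).2 (hy0 i), funext fun i => ?_⟩
  simp [val_substPow]

variable [Fintype ι]

theorem tropTerm_map_substPow (c : ℚ) (hc : 0 < c) (f : MvPolynomial ι (Puiseux k))
    (a : ι →₀ ℕ) (x : ι → ℝ) :
    tropTerm (f.map (substPow c hc)) a ((c : ℝ) • x) = c * tropTerm f a x := by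
  rw [tropTerm, tropTerm, coeff_map, val_substPow, mul_add, Finset.mul_sum, mul_neg]
  simp only [Pi.smul_apply, smul_eq_mul, mul_left_comm]

theorem IsDominant.map_substPow (c : ℚ) (hc : 0 < c) {f : MvPolynomial ι (Puiseux k)}
    {a : ι →₀ ℕ} {x : ι → ℝ} (h : IsDominant f a x) :
    IsDominant (f.map (substPow c hc)) a ((c : ℝ) • x) := by
  obtain ⟨ha, hlt⟩ := h
  rw [IsDominant, support_map_of_injective f (substPow c hc).injective]
  refine ⟨ha, fun b hb hba => ?_⟩
  rw [tropTerm_map_substPow, tropTerm_map_substPow]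
  exact mul_lt_mul_of_pos_left (hlt b hb hba) (by exact_mod_cast hc)

theorem smul_mem_tropicalVariety_map {c : ℚ} (hc : 0 < c)
    (hφ : (substPow c⁻¹ (inv_pos.2 hc)).comp φ = φ) {J : Ideal (MvPolynomial ι R)} {x : ι → ℝ}
    (hx : x ∈ tropicalVariety (J.map (MvPolynomial.map φ))) :
    (c : ℝ) • x ∈ tropicalVariety (J.map (MvPolynomial.map φ)) := by
  rw [mem_tropicalVariety_iff] at hx ⊢
  intro f hf a ha
  have hdom := ha.map_substPow c⁻¹ (inv_pos.2 hc)
  have hc' : (c : ℝ) ≠ 0 := by exact_mod_cast hc.ne'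
  rw [Rat.cast_inv, inv_smul_smul₀ hc'] at hdom
  exact hx _ (map_map_le_comap_map hφ J hf) a hdom

end Rescaling

/-! ### The rational normal curve -/

section RationalNormalCurve

variable {m n : ℕ}

@[to_additive]
theorem prod_idx_two {M : Type*} [CommMonoid M] (F : Fin m → Fin m → M) :
    ∏ p : Idx 2 m, F (p 0) (p 1) = ∏ i, ∏ j ∈ Finset.Ioi i, F i j := by
  rw [Finset.prod_sigma']
  refine Finset.prod_bij' (fun p _ => ⟨p 0, p 1⟩)
    (fun q hq => pairIdx q.1 q.2 (by simpa using hq)) ?_ ?_ ?_ ?_ ?_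
  · intro p _
    simp
  · simp
  · intro p _
    ext r
    fin_cases r <;> rfl
  · intro q _
    rfl
  · intro p _
    rfl

/-- The exponent of the monomial `∏ x_{s i, s j}` over all `i < j`; the pairs `i < j` are the
elements `p : Idx 2 m`, and the pair `s i < s j` is then `p.trans s`. -/
def pairsExp (s : Idx m n) : Idx 2 n →₀ ℕ :=
  ∑ p : Idx 2 m, Finsupp.single (p.trans s) 1

theorem monomial_pairsExp (R : Type*) [CommSemiring R] (s : Idx m n) :
    (monomial (pairsExp s) 1 : MvPolynomial (Idx 2 n) R) = ∏ p : Idx 2 m, X (p.trans s) :=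
  monomial_sum_one _ _

theorem tropMonomialMap_pairsExp (x : Idx 2 n → ℝ) (s : Idx m n) :
    tropMonomialMap pairsExp x s = ∑ p : Idx 2 m, x (p.trans s) := by
  classical
  simp only [tropMonomialMap, pairsExp, Finsupp.coe_finsetSum, Finset.sum_apply, Nat.cast_sum,
    Finset.sum_mul]
  rw [Finset.sum_comm]
  simp [Finsupp.single_apply]

/-- The generic `m × n` matrix whose columns lie on the cone over the rational normal curve: a
column `(a, b)` of the generic `2 × n` matrix gives the column `(b ^ i * a ^ (m - 1 - i))`. -/
def rationalNormalMatrix (m n : ℕ) (p : Fin m × Fin n) : MvPolynomial (Fin 2 × Fin n) ℤ :=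
  X (1, p.2) ^ (p.1 : ℕ) * X (0, p.2) ^ (p.1.rev : ℕ)

theorem genericMinor_two (p : Idx 2 n) :
    genericMinor 2 n p = X (1, p 1) * X (0, p 0) - X (1, p 0) * X (0, p 1) := by
  simp only [genericMinor, Matrix.det_fin_two, Matrix.submatrix_apply, id,
    Matrix.mvPolynomialX_apply]
  ring

theorem aeval_rationalNormalMatrix_genericMinor (s : Idx m n) :
    aeval (rationalNormalMatrix m n) (genericMinor m n s) =
      ∏ p : Idx 2 m, genericMinor 2 n (p.trans s) := by
  have hmatrix : (aeval (rationalNormalMatrix m n)).mapMatrix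
      ((Matrix.mvPolynomialX (Fin m) (Fin n) ℤ).submatrix id s) =
        (Matrix.projVandermonde (fun i => X (1, s i)) (fun i => X (0, s i))).transpose := by
    ext1 i j
    simp [rationalNormalMatrix, Matrix.projVandermonde_apply]
  rw [genericMinor, AlgHom.map_det, hmatrix, Matrix.det_transpose, Matrix.det_projVandermonde,
    ← prod_idx_two]
  simp only [genericMinor_two, RelEmbedding.coe_trans, Function.comp_apply]

theorem pluckerIdeal_le_comap_monomialHom :
    pluckerIdeal m n ≤ (pluckerIdeal 2 n).comap (monomialHom ℤ pairsExp) := by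
  have hcomp : (aeval (genericMinor 2 n)).comp (monomialHom ℤ pairsExp) =
      (aeval (rationalNormalMatrix m n)).comp
        (aeval (genericMinor m n) : _ →ₐ[ℤ] MvPolynomial (Fin m × Fin n) ℤ) := by
    ext1 s
    rw [AlgHom.comp_apply, AlgHom.comp_apply, monomialHom, bind₁_X_right, monomial_pairsExp,
      map_prod, aeval_X, aeval_rationalNormalMatrix_genericMinor]
    simp only [aeval_X]
  intro f hf
  have hf0 : aeval (genericMinor m n) f = 0 := hf
  have hfcomp := DFunLike.congr_fun hcomp f
  rwa [AlgHom.comp_apply, AlgHom.comp_apply, hf0, map_zero] at hfcomp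

theorem pluckerIdealPuiseux_le_comap_monomialHom (k : Type*) [Field k] :
    pluckerIdealPuiseux k m n ≤
      (pluckerIdealPuiseux k 2 n).comap (monomialHom (Puiseux k) pairsExp) :=
  map_map_le_comap_monomialHom _ _ pluckerIdeal_le_comap_monomialHom

theorem dissim_apply (x : Idx 2 n → ℝ) (p : Idx 2 n) : dissim x (p 0) (p 1) = x p := by
  rw [dissim, dif_pos (p.strictMono Fin.zero_lt_one)]
  congr 1
  ext r
  fin_cases r <;> rfl

theorem phi_three_eq_half_sum (x : Idx 2 n → ℝ) (s : Idx 3 n) :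
    phi 3 x s = ((1 / 2 : ℚ) : ℝ) * ∑ p : Idx 2 3, x (p.trans s) := by
  have hsum := sum_idx_two (m := 3) fun i j => dissim x (s i) (s j)
  have hpair (p : Idx 2 3) : dissim x (s (p 0)) (s (p 1)) = x (p.trans s) :=
    dissim_apply x (p.trans s)
  simp only [hpair] at hsum
  rw [phi_three, hsum]
  have hIoi : Finset.Ioi (0 : Fin 3) = {1, 2} ∧ Finset.Ioi (1 : Fin 3) = {2} ∧
      Finset.Ioi (2 : Fin 3) = ∅ := by decide
  simp [Fin.sum_univ_three, hIoi]

end RationalNormalCurve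

end TropicalDissimilarity

end

open TropicalDissimilarity in
theorem mainTheorem3_general (k : Type*) [Field k] (m n : ℕ) {c : ℚ} (hc : 0 < c) :
    (fun (x : Idx 2 n → ℝ) (s : Idx m n) => (c : ℝ) * ∑ p : Idx 2 m, x (p.trans s)) ''
          tropicalGrassmannian k 2 n ⊆ tropicalGrassmannian k m n ∧
      (fun (x : Idx 2 n → ℝ) (s : Idx m n) => (c : ℝ) * ∑ p : Idx 2 m, x (p.trans s)) ''
          tropicalGrassmannianClosure k 2 n ⊆ tropicalGrassmannianClosure k m n := by
  have hmap : (fun (x : Idx 2 n → ℝ) (s : Idx m n) => (c : ℝ) * ∑ p : Idx 2 m, x (p.trans s)) =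
      fun x => (c : ℝ) • tropMonomialMap pairsExp x := by
    ext x s
    simp [tropMonomialMap_pairsExp]
  have hle := pluckerIdealPuiseux_le_comap_monomialHom (m := m) (n := n) k
  rw [hmap, Set.image_subset_iff, Set.image_subset_iff]
  exact ⟨fun x hx => smul_mem_tropicalVariety_map hc (RingHom.ext_int _ _)
      (tropMonomialMap_mem_tropicalVariety hle hx),
    fun x hx => smul_mem_tropicalVarietyClosure_map hc (RingHom.ext_int _ _)
      (tropMonomialMap_mem_tropicalVarietyClosure hle hx)⟩

theorem mainTheorem3 (k : Type*) [Field k] [CharZero k] (n : ℕ) :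
    TropicalDissimilarity.phi 3 '' TropicalDissimilarity.tropicalGrassmannian k 2 n ⊆
        TropicalDissimilarity.tropicalGrassmannian k 3 n ∧
      TropicalDissimilarity.phi 3 '' TropicalDissimilarity.tropicalGrassmannianClosure k 2 n ⊆
        TropicalDissimilarity.tropicalGrassmannianClosure k 3 n := by
  rw [funext₂ TropicalDissimilarity.phi_three_eq_half_sum]
  exact mainTheorem3_general k 3 n one_half_pos
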